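/- Let $K\ge 1$, $[K]=\{1,\dots,K\}$, $\Delta_K=\{\mathbf p\in\mathbb R^K: p_k\ge 0,\ \sum_k p_k=1\}$, let $\alpha>0$, let $c_y\ge 0$ for $y\in[K]$ be margins, and put $c_{k,y}=c_y\,\mathbb I(y\ne k)$ and $\mathrm{KL}(\mathbf p,\tfrac1K)=\sum_k p_k\log(Kp_k)$. For $\lambda\in[0,\infty]$, a score vector $\mathbf f\in\mathbb R^K$ and a label $y\in[K]$, the LDR-KL loss is $$\psi^{\rm KL}_\lambda(\mathbf f,y)=\max_{\mathbf p\in\Delta_K}\Big[\sum_{k=1}^K p_k\,(f_k-f_y+c_{k,y})-\lambda\,\mathrm{KL}(\mathbf p,\tfrac1K)\Big],$$ and for $\lambda_0\in[0,\infty]$ the adaptive (ALDR-KL) loss is $$\psi^{\rm KL}_{\alpha,\lambda_0}(\mathbf f,y)=\max_{\lambda}\Big[\psi^{\rm KL}_\lambda(\mathbf f,y)-\frac\alpha2(\lambda-\lambda_0)^2\Big],$$ where $\lambda$ ranges over $[0,\infty]$, with the conventions $\infty\cdot 0=0$, $|\infty-\infty|=0$ and $|\lambda-\infty|=\infty$ for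 finite $\lambda$. (For finite $\lambda_0$ only $\lambda\in[0,\infty)$ matters; for $\lambda_0=\infty$ only $\lambda=\infty$ matters.) Let $\mathbb P$ be a probability distribution on $\mathcal X\times[K]$, where $\mathcal X$ is a measurable space. For a loss $\psi$, a set $\mathcal C\subseteq\mathbb R^K$ and a measurable $f:\mathcal X\to\mathbb R^K$ put $L_\psi(f)=\mathrm E_{(\mathbf x,y)\sim\mathbb P}[\psi(f(\mathbf x),y)]$ and $L_\psi^*=\inf L_\psi(f)$ over all measurable $f:\mathcal X\to\mathcal C$. For $k\in[K]$ let $r_k$ be a measurable top-$k$ selector, which selects the indices of $k$ largest entries of a vector with an arbitrary rule for breaking ties; put $L_{\mathrm{err}_k}(f)=\Pr_{(\mathbf x,y)\sim\mathbb P}[y\notin r_k(f(\mathbf x))]$ and $L^*_{\mathrm{err}_k}=\inf L_{\mathrm{err}_k}(f)$ over all measurable $f:\mathcal X\to\mathbb R^K$. The loss $\psi$ is All-$k$ consistent (for predictions in $\mathcal C$) if for every $\mathbb P$, every $k\in[K]$, every $r_k$ and every sequence of measurable $f^{(n)}:\mathcal X\to\mathcal C$, $$L_\psi(f^{(n)})\to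 L_\psi^*\ \Longrightarrow\ L_{\mathrm{err}_k}(f^{(n)})\to L^*_{\mathrm{err}_k}.$$ The loss $\psi$ is symmetric if $\sum_{j=1}^K\psi(\mathbf f,j)$ is a constant independent of $\mathbf f\in\mathbb R^K$. Then: 1. if $c_y=0$ for all $y$, $\lambda_0\in(0,\infty)$ and $\alpha>\frac{\log K}{\lambda_0}$, then $\psi^{\rm KL}_{\alpha,\lambda_0}$ is All-$k$ consistent with $\mathcal C=\mathbb R^K$; 2. if $\lambda_0=\infty$, then for every $B>0$ (and arbitrary margins $c_y\ge0$) $\psi^{\rm KL}_{\alpha,\infty}$ is All-$k$ consistent with $\mathcal C=\{\mathbf f\in\mathbb R^K:\|\mathbf f\|_2\le B\}$; 3. if $\lambda_0=\infty$ (and for arbitrary margins $c_y\ge0$), then $\psi^{\rm KL}_{\alpha,\infty}$ is symmetric. -/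

import Mathlib

open Filter Topology MeasureTheory
open scoped ENNReal

noncomputable section

/-- A score vector in `ℝ^K`, with the Euclidean norm. -/
abbrev Score (K : ℕ) : Type := EuclideanSpace ℝ (Fin K)

/-- A loss `ψ(f(x), y)`, as a function of the score vector `f(x)` and of the label `y`. Values are
in the extended reals, so that no supremum below needs a convention for unbounded sets. -/
abbrev LabelLoss (K : ℕ) : Type := Score K → Fin K → EReal

/-- The margin `c_{k,y} = c_y 𝟙(y ≠ k)`. -/
def margin {K : ℕ} (c : Fin K → ℝ) (k y : Fin K) : ℝ := if y ≠ k then c y else 0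

/-- `KL(p, 1/K) = ∑ₖ pₖ log (pₖ K)`, with `0 log 0 = 0`. -/
def klUniform {K : ℕ} (p : Fin K → ℝ) : ℝ := ∑ k, p k * Real.log (p k * K)

/-- The LDR-KL loss with regularization parameter `lam ∈ [0, ∞]`:
`max_{p ∈ Δ_K} ∑ₖ pₖ (f_k - f_y + c_{k,y}) - lam KL(p, 1/K)`.
For `lam = ∞` the products are those of `[0, ∞]`: `∞ * 0 = 0` and `∞ * t = ∞` for `t > 0`. -/
def ldrKL {K : ℕ} (c : Fin K → ℝ) (lam : ℝ≥0∞) : LabelLoss K := fun v y =>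
  ⨆ p ∈ stdSimplex ℝ (Fin K),
    ((∑ k, p k * (v k - v y + margin c k y) : ℝ) : EReal)
      - ((lam * ENNReal.ofReal (klUniform p) : ℝ≥0∞) : EReal)

/-- `|a - b|` on `[0, ∞]`, with `|∞ - ∞| = 0` and `|a - ∞| = ∞` for finite `a`
(subtraction on `ℝ≥0∞` is truncated at `0`). -/
def absDiff (a b : ℝ≥0∞) : ℝ≥0∞ := (a - b) + (b - a)

/-- The ALDR-KL loss `max_{lam ≥ 0} [LDR-KL_lam - (α / 2) (lam - lam0)²]`, for `lam0 ∈ [0, ∞]`.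
For finite `lam0` the value `lam = ∞` contributes `-∞`, so that the supremum is over finite `lam`;
for `lam0 = ∞` every finite `lam` contributes `-∞`. -/
def aldrKL {K : ℕ} (α : ℝ) (lam0 : ℝ≥0∞) (c : Fin K → ℝ) : LabelLoss K := fun v y =>
  ⨆ lam : ℝ≥0∞,
    ldrKL c lam v y - ((ENNReal.ofReal (α / 2) * absDiff lam lam0 ^ 2 : ℝ≥0∞) : EReal)

/-- Expectation of an extended-real function: integral of the positive part minus integral of the
negative part (so it is `+∞` if the negative part alone has a finite integral). -/
def extExpectation {Ω : Type*} [MeasurableSpace Ω] (P : Measure Ω) (g : Ω → EReal) : EReal :=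
  ((∫⁻ ω, (g ω).toENNReal ∂P : ℝ≥0∞) : EReal) - ((∫⁻ ω, (-g ω).toENNReal ∂P : ℝ≥0∞) : EReal)

section Consistency

variable {K : ℕ} {X : Type*} [MeasurableSpace X]

/-- The risk `L_ψ(f) = E_{(x,y) ∼ P} ψ(f(x), y)`. -/
def lossRisk (P : Measure (X × Fin K)) (ψ : LabelLoss K) (f : X → Score K) : EReal :=
  extExpectation P fun z => ψ (f z.1) z.2

/-- The infimum of the risk over all measurable predictors with values in `C`. -/
def optLossRisk (P : Measure (X × Fin K)) (C : Set (Score K)) (ψ : LabelLoss K) : EReal :=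
  ⨅ (f : X → Score K) (_ : Measurable f) (_ : ∀ x, f x ∈ C), lossRisk P ψ f

/-- `r` is a (measurable) top-`k` selector: it selects `k` indices of largest entries,
with an arbitrary rule for breaking ties. -/
structure IsTopKSelector (k : ℕ) (r : Score K → Finset (Fin K)) : Prop where
  card_eq : ∀ v, (r v).card = k
  le_of_mem : ∀ v, ∀ i ∈ r v, ∀ j ∉ r v, v j ≤ v i
  measurable : ∀ y, MeasurableSet {v | y ∈ r v}

/-- The top-`k` error risk `L_{err_k}(f) = E_{(x,y) ∼ P} 𝟙(y ∉ r_k(f(x)))`. -/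
def errRisk (P : Measure (X × Fin K)) (r : Score K → Finset (Fin K)) (f : X → Score K) : ℝ≥0∞ :=
  ∫⁻ z, (if z.2 ∉ r (f z.1) then 1 else 0) ∂P

/-- The Bayes top-`k` error: the infimum over all measurable `f : X → ℝ^K`. -/
def bayesErr (P : Measure (X × Fin K)) (r : Score K → Finset (Fin K)) : ℝ≥0∞ :=
  ⨅ (f : X → Score K) (_ : Measurable f), errRisk P r f

/-- Top-`k` consistency of `ψ` for the data distribution `P` and predictors with values in `C`,
for every way of breaking ties in the top-`k` selector. -/
def IsTopKConsistent (P : Measure (X × Fin K)) (C : Set (Score K)) (ψ : LabelLoss K)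
    (k : ℕ) : Prop :=
  ∀ r : Score K → Finset (Fin K), IsTopKSelector k r →
    ∀ f : ℕ → X → Score K, (∀ n, Measurable (f n)) → (∀ n x, f n x ∈ C) →
      Tendsto (fun n => lossRisk P ψ (f n)) atTop (𝓝 (optLossRisk P C ψ)) →
        Tendsto (fun n => errRisk P r (f n)) atTop (𝓝 (bayesErr P r))

/-- All-`k` consistency: top-`k` consistency for every `k ∈ {1, …, K}`. -/
def IsAllKConsistent (P : Measure (X × Fin K)) (C : Set (Score K)) (ψ : LabelLoss K) : Prop :=
  ∀ k, 1 ≤ k → k ≤ K → IsTopKConsistent P C ψ k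

end Consistency

/-- A loss is symmetric if the sum of its values over all labels is a (finite) constant. -/
def IsSymmetricLoss {K : ℕ} (ψ : LabelLoss K) : Prop :=
  ∃ a : ℝ, ∀ v : Score K, ∑ j, ψ v j = (a : EReal)

end

/-!
Both consistency claims come from one improvement argument. Disintegrate `P` into its marginal on
`X` and the label probabilities `q x`. Suppose that, whenever `q j < q i` but `v i ≤ v j`, some
measurable correction of `v` lowers the conditional risk by at least `δ q > 0`, uniformly in `v`.
Correcting the predictors of a risk-minimizing sequence on the set where they order `i` and `j`
wrongly cannot beat the infimum, so the integral of `δ (q x)` over that set tends to zero, hence so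
does its probability. Outside these sets every top-`k` choice is optimal, so the excess top-`k`
error is at most the sum of these probabilities. No attained minimizer of the conditional risk is
needed (for finite `lam0` there may be none), and ties in the selector cost nothing, because a tie
counts as a wrong order. This is `isAllKConsistent_of_improvement`.

For `lam0 = ∞` only `lam = ∞` and uniform weights survive, and the loss is affine in the scores
(`aldrKL_top`), which makes symmetry a computation. With `w = q - 1/K` the conditional risk is a
constant minus `⟪w, v⟫`. The correction on the ball of radius `B` is its minimizer `B w / ‖w‖`; a
wrongly ordered `v` satisfies `⟪w, v⟫ ≤ B ‖w'‖`, where `w'` averages the coordinates `i` and `j` of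
`w` and has strictly smaller norm.

For finite `lam0` and no margins, maximizing over `lam` first gives the loss `G v - v y`, where `G`
is the convex conjugate of `lam0 KL - KL² / (2 α)` on the simplex (`aldrKL_eq`). Since
`log K < α lam0`, this penalty increases with `KL` at rate at least `m = lam0 - log K / α > 0`. The
correction replaces `v i` and `v j` by their mean plus and minus `ε`. By strong convexity of `KL` it
raises `G` by at most `2 ε² / m` (`adaptiveConjugate_separateScore_le`), while the pairing with `q`
grows by at least `ε (q i - q j)`; a suitable `ε` gives `δ q = m (q i - q j)² / 8`.
-/

/-! ### Disintegration of the data distribution and of the risks -/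

/-- The conditional risk `∑ y, q y * ℓ(v, y)` of a score vector `v` when the label has the
probability vector `q`. -/
noncomputable def condRisk {K : ℕ} (ℓ : Score K → Fin K → ℝ) (q v : Score K) : ℝ :=
  ∑ y, q y * ℓ v y

/-- The conditional probabilities of the labels given the features, as a measurable map to the
simplex. -/
theorem exists_labelProbabilities {K : ℕ} {X : Type*} [MeasurableSpace X]
    (P : Measure (X × Fin K)) [IsProbabilityMeasure P] :
    ∃ q : X → Score K, Measurable q ∧ (∀ x, ⇑(q x) ∈ stdSimplex ℝ (Fin K)) ∧
      ∀ g : X × Fin K → ℝ≥0∞, Measurable g →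
        ∫⁻ z, g z ∂P = ∫⁻ x, ∑ y, ENNReal.ofReal (q x y) * g (x, y) ∂P.fst := by
  have hne : Nonempty (Fin K) := by
    have : Nonempty (X × Fin K) := nonempty_of_isProbabilityMeasure P
    exact this.map Prod.snd
  refine ⟨fun x => WithLp.toLp 2 fun y => (P.condKernel x).real {y}, ?_, fun x => ⟨?_, ?_⟩, ?_⟩
  · refine (WithLp.measurable_toLp 2 _).comp (measurable_pi_lambda _ fun y => ?_)
    exact (P.condKernel.measurable_coe (measurableSet_singleton y)).ennreal_toReal
  · intro y
    exact measureReal_nonneg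
  · simp
  · intro g hg
    rw [← Measure.lintegral_condKernel hg]
    refine lintegral_congr fun x => ?_
    rw [lintegral_fintype]
    refine Finset.sum_congr rfl fun y _ => ?_
    simp [mul_comm]

theorem sum_ofReal_mul_ofReal_add {K : ℕ} {ℓ : Score K → Fin K → ℝ} {M : ℝ} {q v : Score K}
    (hq : ⇑q ∈ stdSimplex ℝ (Fin K)) (hM : ∀ y, -M ≤ ℓ v y) :
    ∑ y, ENNReal.ofReal (q y) * ENNReal.ofReal (ℓ v y + M)
      = ENNReal.ofReal (condRisk ℓ q v + M) := by
  have h : condRisk ℓ q v + M = ∑ y, q y * (ℓ v y + M) := by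
    simp only [mul_add, Finset.sum_add_distrib, ← Finset.sum_mul, condRisk, hq.2, one_mul]
  rw [h, ENNReal.ofReal_sum_of_nonneg]
  · exact Finset.sum_congr rfl fun y _ => (ENNReal.ofReal_mul (hq.1 y)).symm
  · exact fun y _ => mul_nonneg (hq.1 y) (by linarith [hM y])

/-- For a real function bounded below, the extended expectation is a nonnegative Lebesgue integral
minus a real constant. -/
theorem extExpectation_coe_of_bddBelow {Ω : Type*} [MeasurableSpace Ω] (P : Measure Ω)
    [IsProbabilityMeasure P] {g : Ω → ℝ} (hg : Measurable g) {M : ℝ} (hM0 : 0 ≤ M)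
    (hM : ∀ ω, -M ≤ g ω) :
    extExpectation P (fun ω => (g ω : EReal))
      = ((∫⁻ ω, ENNReal.ofReal (g ω + M) ∂P : ℝ≥0∞) : EReal) - (M : EReal) := by
  have hsplit : ∫⁻ ω, ENNReal.ofReal (g ω + M) ∂P + ∫⁻ ω, ENNReal.ofReal (-g ω) ∂P
      = ∫⁻ ω, ENNReal.ofReal (g ω) ∂P + ENNReal.ofReal M := by
    have hc : ENNReal.ofReal M = ∫⁻ _, ENNReal.ofReal M ∂P := by simp
    rw [hc, ← lintegral_add_left (by fun_prop), ← lintegral_add_left (by fun_prop)]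
    refine lintegral_congr fun ω => ?_
    rcases le_total 0 (g ω) with h | h
    · rw [ENNReal.ofReal_of_nonpos (neg_nonpos.2 h), add_zero, ENNReal.ofReal_add h hM0]
    · rw [ENNReal.ofReal_of_nonpos h, zero_add,
        ← ENNReal.ofReal_add (by linarith [hM ω]) (by linarith)]
      congr 1
      ring
  have hneg : ∫⁻ ω, ENNReal.ofReal (-g ω) ∂P ≠ ∞ := by
    refine ne_top_of_le_ne_top (b := ∫⁻ _, ENNReal.ofReal M ∂P) (by simp) ?_
    exact lintegral_mono fun ω => ENNReal.ofReal_le_ofReal (by linarith [hM ω])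
  have hpos : extExpectation P (fun ω => (g ω : EReal))
      = ((∫⁻ ω, ENNReal.ofReal (g ω) ∂P : ℝ≥0∞) : EReal)
        - ((∫⁻ ω, ENNReal.ofReal (-g ω) ∂P : ℝ≥0∞) : EReal) := by
    simp only [extExpectation, ← EReal.coe_neg, EReal.toENNReal_of_ne_top (EReal.coe_ne_top _),
      EReal.toReal_coe]
  rw [hpos]
  generalize ∫⁻ ω, ENNReal.ofReal (g ω + M) ∂P = A at *
  generalize ∫⁻ ω, ENNReal.ofReal (-g ω) ∂P = N at *
  generalize ∫⁻ ω, ENNReal.ofReal (g ω) ∂P = B at *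
  lift N to NNReal using hneg
  by_cases hB : B = ∞
  · subst hB
    have hA : A = ∞ := by
      by_contra hA
      exact hA (by simpa using hsplit)
    subst hA
    simp only [EReal.coe_ennreal_top, EReal.top_sub_coe]
    exact EReal.top_sub_coe (N : ℝ)
  · have hA : A ≠ ∞ := by
      intro hA
      subst hA
      exact hB (by simpa using hsplit.symm)
    lift A to NNReal using hA
    lift B to NNReal using hB
    have h := congrArg ENNReal.toReal hsplit
    rw [ENNReal.toReal_add (by simp) (by simp), ENNReal.toReal_add (by simp) (by simp),
      ENNReal.toReal_ofReal hM0] at h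
    simp only [ENNReal.coe_toReal] at h
    change ((B : ℝ) : EReal) - ((N : ℝ) : EReal) = ((A : ℝ) : EReal) - (M : EReal)
    rw [← EReal.coe_sub, ← EReal.coe_sub]
    congr 1
    linarith

/-! ### Top-`k` sets and order mistakes -/

/-- A set of indices of largest entries carries at least as much mass as any set of the same
size. -/
theorem sum_le_sum_of_card_eq {ι : Type*} [DecidableEq ι] {q : ι → ℝ} {S T : Finset ι}
    (hcard : S.card = T.card) (h : ∀ i ∈ S, ∀ j ∉ S, q j ≤ q i) :
    ∑ i ∈ T, q i ≤ ∑ i ∈ S, q i := by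
  have hc : (T \ S).card = (S \ T).card := by
    have h1 := Finset.card_sdiff_add_card_inter T S
    have h2 := Finset.card_sdiff_add_card_inter S T
    rw [Finset.inter_comm] at h2
    omega
  have hd : ∑ i ∈ T \ S, q i ≤ ∑ i ∈ S \ T, q i := by
    let e := Finset.equivOfCardEq hc
    rw [← Finset.sum_coe_sort (T \ S), ← Finset.sum_coe_sort (S \ T), ← e.sum_comp]
    refine Finset.sum_le_sum fun t _ => ?_
    exact h _ (Finset.mem_sdiff.1 (e t).2).1 _ (Finset.mem_sdiff.1 t.2).2
  have h1 := Finset.sum_inter_add_sum_sdiff T S q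
  have h2 := Finset.sum_inter_add_sum_sdiff S T q
  rw [Finset.inter_comm] at h2
  linarith

/-- If `v` orders no pair of labels against `q`, the error probability of a top-`k` set of `v` is
at most that of any other set of the same size. -/
theorem sum_compl_le_of_topk {K : ℕ} {q v : Score K} {S T : Finset (Fin K)}
    (hcard : S.card = T.card) (hS : ∀ i ∈ S, ∀ j ∉ S, v j ≤ v i)
    (hv : ∀ i j, q j < q i → ¬ v i ≤ v j) :
    ∑ y ∈ Sᶜ, q y ≤ ∑ y ∈ Tᶜ, q y := by
  have h := sum_le_sum_of_card_eq (q := q) hcard fun i hi j hj =>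
    not_lt.1 fun hlt => hv j i hlt (hS i hi j hj)
  have h1 := Finset.sum_add_sum_compl S q
  have h2 := Finset.sum_add_sum_compl T q
  linarith

/-- The points where the predictor `f` orders the labels `i`, `j` against strictly different
conditional probabilities (a tie counts as a mistake). -/
def orderMistake {K : ℕ} {X : Type*} (q f : X → Score K) (i j : Fin K) : Set X :=
  {x | q x j < q x i ∧ f x i ≤ f x j}

theorem measurableSet_orderMistake {K : ℕ} {X : Type*} [MeasurableSpace X] {q f : X → Score K}
    (hq : Measurable q) (hf : Measurable f) (i j : Fin K) :
    MeasurableSet (orderMistake q f i j) := by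
  have hcoord : ∀ {g : X → Score K}, Measurable g → ∀ y, Measurable fun x => g x y :=
    fun hg y => by fun_prop
  exact (measurableSet_lt (hcoord hq j) (hcoord hq i)).inter
    (measurableSet_le (hcoord hf i) (hcoord hf j))

/-- The excess top-`k` error is at most the total probability of order mistakes. -/
theorem errRisk_le_bayesErr_add {K : ℕ} {X : Type*} [MeasurableSpace X]
    {P : Measure (X × Fin K)} {q : X → Score K} (hq : Measurable q)
    (hsimplex : ∀ x, ⇑(q x) ∈ stdSimplex ℝ (Fin K))
    (hP : ∀ g : X × Fin K → ℝ≥0∞, Measurable g →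
      ∫⁻ z, g z ∂P = ∫⁻ x, ∑ y, ENNReal.ofReal (q x y) * g (x, y) ∂P.fst)
    {k : ℕ} {r : Score K → Finset (Fin K)} (hr : IsTopKSelector k r) {f : X → Score K}
    (hf : Measurable f) :
    errRisk P r f ≤ bayesErr P r + ∑ i, ∑ j, P.fst (orderMistake q f i j) := by
  classical
  have herr : ∀ g : X → Score K, Measurable g →
      errRisk P r g = ∫⁻ x, ENNReal.ofReal (∑ y ∈ (r (g x))ᶜ, q x y) ∂P.fst := by
    intro g hg
    have hmeas : Measurable fun z : X × Fin K => if z.2 ∉ r (g z.1) then (1 : ℝ≥0∞) else 0 := by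
      refine measurable_from_prod_countable_left fun y => ?_
      exact Measurable.ite ((hr.measurable y).preimage hg).compl measurable_const measurable_const
    rw [errRisk, hP _ hmeas]
    refine lintegral_congr fun x => ?_
    rw [ENNReal.ofReal_sum_of_nonneg fun y _ => (hsimplex x).1 y]
    simp only [mul_ite, mul_one, mul_zero]
    rw [← Finset.sum_filter]
    congr 1
    ext y
    simp
  simp only [bayesErr, ENNReal.iInf_add]
  refine le_iInf fun g => ?_
  by_cases hg : Measurable g
  swap
  · simp [hg]
  simp only [hg, iInf_pos]
  have hind : ∀ i j, P.fst (orderMistake q f i j)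
      = ∫⁻ x, (orderMistake q f i j).indicator 1 x ∂P.fst := fun i j =>
    (lintegral_indicator_one (measurableSet_orderMistake hq hf i j)).symm
  have hm : ∀ i j, Measurable fun x => (orderMistake q f i j).indicator (1 : X → ℝ≥0∞) x :=
    fun i j => measurable_one.indicator (measurableSet_orderMistake hq hf i j)
  simp only [hind]
  simp_rw [← lintegral_finsetSum Finset.univ fun j _ => hm _ j]
  rw [← lintegral_finsetSum Finset.univ fun i _ =>
    Finset.measurable_fun_sum _ fun j _ => hm i j, herr f hf, herr g hg, ← lintegral_add_right _
    (Finset.measurable_fun_sum _ fun i _ => Finset.measurable_fun_sum _ fun j _ => hm i j)]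
  refine lintegral_mono fun x => ?_
  by_cases hx : ∃ i j, x ∈ orderMistake q f i j
  · obtain ⟨i, j, hij⟩ := hx
    have h1 : ENNReal.ofReal (∑ y ∈ (r (f x))ᶜ, q x y) ≤ 1 := by
      rw [← ENNReal.ofReal_one, ← (hsimplex x).2]
      exact ENNReal.ofReal_le_ofReal (Finset.sum_le_univ_sum_of_nonneg (hsimplex x).1)
    refine h1.trans (le_add_left ?_)
    calc (1 : ℝ≥0∞) = (orderMistake q f i j).indicator 1 x := by simp [hij]
      _ ≤ ∑ j, (orderMistake q f i j).indicator 1 x :=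
        Finset.single_le_sum (f := fun j => (orderMistake q f i j).indicator (1 : X → ℝ≥0∞) x)
          (fun _ _ => zero_le) (Finset.mem_univ j)
      _ ≤ _ := Finset.single_le_sum
          (f := fun i => ∑ j, (orderMistake q f i j).indicator (1 : X → ℝ≥0∞) x)
          (fun _ _ => zero_le) (Finset.mem_univ i)
  · refine le_add_right (ENNReal.ofReal_le_ofReal ?_)
    refine sum_compl_le_of_topk ((hr.card_eq _).trans (hr.card_eq _).symm) (hr.le_of_mem (f x)) ?_
    exact fun i j hlt hle => hx ⟨i, j, hlt, hle⟩

/-! ### From improvement of mistaken scores to consistency -/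

/-- If a weight is positive on sets `s n` and its integrals over them vanish in the limit, so do
their measures. -/
theorem tendsto_measure_zero_of_setLIntegral {X : Type*} [MeasurableSpace X] {μ : Measure X}
    [IsFiniteMeasure μ] {d : X → ℝ≥0∞} (hd : Measurable d) (hd_top : ∀ x, d x ≠ ∞)
    {s : ℕ → Set X} (hs : ∀ n, MeasurableSet (s n)) (hpos : ∀ n, ∀ x ∈ s n, d x ≠ 0)
    (h : Tendsto (fun n => ∫⁻ x in s n, d x ∂μ) atTop (𝓝 0)) :
    Tendsto (fun n => μ (s n)) atTop (𝓝 0) := by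
  have hfin : ∫⁻ x, (d x)⁻¹ ∂(μ.withDensity d) ≠ ∞ := by
    rw [lintegral_withDensity_eq_lintegral_mul _ hd (g := fun x => (d x)⁻¹) hd.inv]
    refine ne_top_of_le_ne_top (b := ∫⁻ _, 1 ∂μ) (by simp) (lintegral_mono fun x => ?_)
    exact ENNReal.mul_inv_le_one (d x)
  have hν : Tendsto (fun n => μ.withDensity d (s n)) atTop (𝓝 0) := by
    simpa only [withDensity_apply _ (hs _)] using h
  refine (tendsto_setLIntegral_zero hfin hν).congr fun n => ?_
  rw [restrict_withDensity (hs n), lintegral_withDensity_eq_lintegral_mul _ hd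
    (g := fun x => (d x)⁻¹) hd.inv, ← setLIntegral_one]
  refine setLIntegral_congr_fun (hs n) fun x hx => ?_
  exact ENNReal.mul_inv_cancel (hpos n x hx) (hd_top x)

/-- The consistency criterion. Suppose that, whenever a score vector `v` orders two labels against
strictly different conditional probabilities, a measurable correction `T q v` lowers the conditional
risk by at least `δ q > 0`, a bound that does not depend on `v`. Correcting a risk-minimizing
sequence then shows that the `δ`-weighted probability of an order mistake tends to zero. -/
theorem isAllKConsistent_of_improvement {K : ℕ} {X : Type*} [MeasurableSpace X]
    (P : Measure (X × Fin K)) [IsProbabilityMeasure P] {C : Set (Score K)} (hC : C.Nonempty)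
    {ℓ : Score K → Fin K → ℝ} (hℓ : ∀ y, Measurable fun v => ℓ v y)
    {M : ℝ} (hM : ∀ v ∈ C, ∀ y, -M ≤ ℓ v y)
    (himp : ∀ i j : Fin K, ∃ (T : Score K → Score K → Score K) (δ : Score K → ℝ),
      Measurable (Function.uncurry T) ∧ Measurable δ ∧ (∀ q, ∀ v ∈ C, T q v ∈ C) ∧
      ∀ q : Score K, ⇑q ∈ stdSimplex ℝ (Fin K) → q j < q i → 0 < δ q ∧
        ∀ v ∈ C, v i ≤ v j → condRisk ℓ q (T q v) + δ q ≤ condRisk ℓ q v) :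
    IsAllKConsistent P C (fun v y => (ℓ v y : EReal)) := by
  classical
  wlog hM0 : 0 ≤ M generalizing M
  · exact this (M := 0) (fun v hv y => by linarith [hM v hv y]) le_rfl
  obtain ⟨q, hq, hsimplex, hP⟩ := exists_labelProbabilities P
  intro k _ _ r hr f hf hfC hlim
  set ψ : LabelLoss K := fun v y => (ℓ v y : EReal) with hψ
  -- The risk shifted by the lower bound, as a Lebesgue integral.
  let A : (X → Score K) → ℝ≥0∞ := fun g => ∫⁻ z, ENNReal.ofReal (ℓ (g z.1) z.2 + M) ∂P
  have hmeas : ∀ g : X → Score K, Measurable g → Measurable fun z : X × Fin K => ℓ (g z.1) z.2 :=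
    fun g hg => measurable_from_prod_countable_left fun y => (hℓ y).comp hg
  have hrisk : ∀ g : X → Score K, Measurable g → (∀ x, g x ∈ C) →
      lossRisk P ψ g = (A g : EReal) - (M : EReal) := fun g hg hgC =>
    extExpectation_coe_of_bddBelow P (hmeas g hg) hM0 fun z => hM _ (hgC z.1) z.2
  have hA : ∀ g : X → Score K, Measurable g → (∀ x, g x ∈ C) →
      A g = ∫⁻ x, ENNReal.ofReal (condRisk ℓ (q x) (g x) + M) ∂P.fst := by
    intro g hg hgC
    change ∫⁻ z, ENNReal.ofReal (ℓ (g z.1) z.2 + M) ∂P = _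
    rw [hP _ ((hmeas g hg).add_const M).ennreal_ofReal]
    exact lintegral_congr fun x => sum_ofReal_mul_ofReal_add (hsimplex x) (hM _ (hgC x))
  have hopt_le : ∀ g : X → Score K, Measurable g → (∀ x, g x ∈ C) →
      optLossRisk P C ψ ≤ lossRisk P ψ g := fun g hg hgC =>
    (iInf_le _ g).trans ((iInf_le _ hg).trans (iInf_le _ hgC))
  -- The optimal risk is a real number.
  obtain ⟨a, ha⟩ : ∃ a : ℝ, optLossRisk P C ψ = (a : EReal) := by
    have hbot : ((-M : ℝ) : EReal) ≤ optLossRisk P C ψ := by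
      refine le_iInf fun g => le_iInf fun hg => le_iInf fun hgC => ?_
      rw [hrisk g hg hgC, EReal.coe_neg, ← zero_sub]
      exact EReal.sub_le_sub (EReal.coe_ennreal_nonneg _) le_rfl
    obtain ⟨v₀, hv₀⟩ := hC
    have htop : optLossRisk P C ψ < ⊤ := by
      refine (hopt_le (fun _ => v₀) measurable_const fun _ => hv₀).trans_lt ?_
      rw [hrisk _ measurable_const fun _ => hv₀]
      have hfin : A (fun _ => v₀) ≠ ∞ := by
        refine ne_top_of_le_ne_top (b := ∑ y, ENNReal.ofReal (ℓ v₀ y + M)) (by simp) ?_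
        calc A (fun _ => v₀) ≤ ∫⁻ _, ∑ y, ENNReal.ofReal (ℓ v₀ y + M) ∂P :=
              lintegral_mono fun z => Finset.single_le_sum
                (f := fun y => ENNReal.ofReal (ℓ v₀ y + M)) (fun _ _ => zero_le)
                (Finset.mem_univ z.2)
          _ = _ := by simp
      lift A (fun _ => v₀) to NNReal using hfin with B
      exact EReal.coe_lt_top ((B : ℝ) - M)
    exact ⟨(optLossRisk P C ψ).toReal,
      (EReal.coe_toReal htop.ne (ne_bot_of_le_ne_bot (EReal.coe_ne_bot _) hbot)).symm⟩
  have hmistake : ∀ i j,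
      Tendsto (fun n => P.fst (orderMistake q (f n) i j)) atTop (𝓝 0) := by
    intro i j
    obtain ⟨T, δ, hT, hδ, hTC, hTδ⟩ := himp i j
    refine tendsto_measure_zero_of_setLIntegral (d := fun x => ENNReal.ofReal (δ (q x)))
      (by fun_prop) (fun _ => ENNReal.ofReal_ne_top)
      (fun n => measurableSet_orderMistake hq (hf n) i j)
      (fun n x hx => (ENNReal.ofReal_pos.2 (hTδ _ (hsimplex x) hx.1).1).ne') ?_
    set e : ℕ → ℝ≥0∞ :=
      fun n => ∫⁻ x in orderMistake q (f n) i j, ENNReal.ofReal (δ (q x)) ∂P.fst with he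
    have hkey : ∀ n, optLossRisk P C ψ + (e n : EReal) ≤ lossRisk P ψ (f n) := by
      intro n
      have hE := measurableSet_orderMistake hq (hf n) i j
      let f' : X → Score K := fun x =>
        if x ∈ orderMistake q (f n) i j then T (q x) (f n x) else f n x
      have hf' : Measurable f' := Measurable.ite hE (hT.comp (hq.prodMk (hf n))) (hf n)
      have hf'C : ∀ x, f' x ∈ C := by
        intro x
        by_cases hx : x ∈ orderMistake q (f n) i j
        · simpa [f', hx] using hTC _ _ (hfC n x)
        · simpa [f', hx] using hfC n x
      have hAe : A f' + e n ≤ A (f n) := by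
        rw [hA _ hf' hf'C, hA _ (hf n) (hfC n), he]
        simp only
        rw [← lintegral_indicator hE, ← lintegral_add_right _
          (Measurable.indicator (by fun_prop) hE)]
        refine lintegral_mono fun x => ?_
        by_cases hx : x ∈ orderMistake q (f n) i j
        · have h := hTδ _ (hsimplex x) hx.1
          have hle := h.2 _ (hfC n x) hx.2
          have hnn : 0 ≤ condRisk ℓ (q x) (T (q x) (f n x)) + M := by
            have hs : ∑ y, q x y * (-M) = -M := by rw [← Finset.sum_mul, (hsimplex x).2, one_mul]
            have : -M ≤ condRisk ℓ (q x) (T (q x) (f n x)) := by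
              rw [← hs]
              exact Finset.sum_le_sum fun y _ => mul_le_mul_of_nonneg_left
                (hM _ (hTC _ _ (hfC n x)) y) ((hsimplex x).1 y)
            linarith
          simp only [f', if_pos hx, Set.indicator_of_mem hx]
          rw [← ENNReal.ofReal_add hnn h.1.le]
          exact ENNReal.ofReal_le_ofReal (by linarith)
        · simp [f', hx]
      calc optLossRisk P C ψ + (e n : EReal) ≤ lossRisk P ψ f' + (e n : EReal) :=
            add_le_add_left (hopt_le f' hf' hf'C) _
        _ = ((A f' + e n : ℝ≥0∞) : EReal) - (M : EReal) := by
            rw [hrisk _ hf' hf'C, EReal.coe_ennreal_add, sub_eq_add_neg, sub_eq_add_neg,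
              add_right_comm]
        _ ≤ lossRisk P ψ (f n) := by
            rw [hrisk _ (hf n) (hfC n)]
            exact EReal.sub_le_sub (EReal.coe_ennreal_le_coe_ennreal_iff.2 hAe) le_rfl
    have hdiff : Tendsto (fun n => lossRisk P ψ (f n) + ((-a : ℝ) : EReal)) atTop (𝓝 0) := by
      have h0 : (0 : EReal) = optLossRisk P C ψ + ((-a : ℝ) : EReal) := by
        rw [ha, ← EReal.coe_add, add_neg_cancel, EReal.coe_zero]
      rw [h0]
      exact (EReal.continuousAt_add (.inr (EReal.coe_ne_bot _))
        (.inr (EReal.coe_ne_top _))).tendsto.comp (hlim.prodMk_nhds tendsto_const_nhds)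
    have he0 : Tendsto (fun n => (e n : EReal)) atTop (𝓝 ((0 : ℝ≥0∞) : EReal)) := by
      refine tendsto_of_tendsto_of_tendsto_of_le_of_le tendsto_const_nhds
        (by simpa using hdiff) (fun n => ?_) fun n => ?_
      · exact EReal.coe_ennreal_le_coe_ennreal_iff.2 zero_le
      · have h := add_le_add_left (hkey n) ((-a : ℝ) : EReal)
        rwa [ha, add_right_comm, ← EReal.coe_add, add_neg_cancel, EReal.coe_zero, zero_add] at h
    exact EReal.tendsto_coe_ennreal.1 he0
  have hsum : Tendsto (fun n => bayesErr P r + ∑ i, ∑ j, P.fst (orderMistake q (f n) i j))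
      atTop (𝓝 (bayesErr P r)) := by
    have h : Tendsto (fun n => ∑ i, ∑ j, P.fst (orderMistake q (f n) i j)) atTop (𝓝 0) := by
      simpa using tendsto_finsetSum (Finset.univ : Finset (Fin K)) fun i _ =>
        tendsto_finsetSum (Finset.univ : Finset (Fin K)) fun j _ => hmistake i j
    simpa using tendsto_const_nhds.add h
  exact tendsto_of_tendsto_of_tendsto_of_le_of_le tendsto_const_nhds hsum
    (fun n => (iInf_le _ (f n)).trans (iInf_le _ (hf n)))
    fun n => errRisk_le_bayesErr_add hq hsimplex hP hr (hf n)

/-! ### The divergence from the uniform distribution -/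

theorem klUniform_eq_sum_klFun {K : ℕ} {p : Fin K → ℝ} (hp : p ∈ stdSimplex ℝ (Fin K)) :
    klUniform p = (∑ k, InformationTheory.klFun (p k * K)) / K := by
  rcases Nat.eq_zero_or_pos K with rfl | hK
  · simp [klUniform]
  have hK' : (K : ℝ) ≠ 0 := by positivity
  have h : ∀ k, InformationTheory.klFun (p k * K)
      = (p k * Real.log (p k * K)) * K + 1 - p k * K := by
    intro k
    rw [InformationTheory.klFun]
    ring
  simp only [h, Finset.sum_sub_distrib, Finset.sum_add_distrib, ← Finset.sum_mul, hp.2]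
  simp [klUniform, hK']

theorem klUniform_nonneg {K : ℕ} {p : Fin K → ℝ} (hp : p ∈ stdSimplex ℝ (Fin K)) :
    0 ≤ klUniform p := by
  rw [klUniform_eq_sum_klFun hp]
  exact div_nonneg (Finset.sum_nonneg fun k _ =>
    InformationTheory.klFun_nonneg (mul_nonneg (hp.1 k) K.cast_nonneg)) K.cast_nonneg

theorem eq_inv_of_klUniform_eq_zero {K : ℕ} {p : Fin K → ℝ} (hp : p ∈ stdSimplex ℝ (Fin K))
    (h : klUniform p = 0) (k : Fin K) : p k = (K : ℝ)⁻¹ := by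
  have hK : (K : ℝ) ≠ 0 := Nat.cast_ne_zero.2 (Fin.pos k).ne'
  have hnn : ∀ k, 0 ≤ p k * K := fun k => mul_nonneg (hp.1 k) K.cast_nonneg
  rw [klUniform_eq_sum_klFun hp, div_eq_zero_iff, or_iff_left hK,
    Finset.sum_eq_zero_iff_of_nonneg fun k _ => InformationTheory.klFun_nonneg (hnn k)] at h
  exact eq_inv_of_mul_eq_one_left
    ((InformationTheory.klFun_eq_zero_iff (hnn k)).1 (h k (Finset.mem_univ k)))

theorem uniform_mem_stdSimplex {K : ℕ} (hK : K ≠ 0) :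
    (fun _ => (K : ℝ)⁻¹) ∈ stdSimplex ℝ (Fin K) :=
  ⟨fun _ => by positivity, by simp [hK]⟩

theorem klUniform_uniform {K : ℕ} : klUniform (fun _ : Fin K => (K : ℝ)⁻¹) = 0 := by
  rcases eq_or_ne K 0 with rfl | hK
  · simp [klUniform]
  · simp [klUniform, hK]

/-! ### The loss with infinite regularization -/

/-- The closed form of the loss for `lam0 = ∞`: only the uniform weights survive. -/
noncomputable def uniformLoss {K : ℕ} (c : Fin K → ℝ) (v : Score K) (y : Fin K) : ℝ :=
  (∑ k, v k) / K - v y + (K - 1) / K * c y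

theorem sum_uniform_mul_margin {K : ℕ} (c : Fin K → ℝ) (v : Score K) (y : Fin K) :
    ∑ k, (K : ℝ)⁻¹ * (v k - v y + margin c k y) = uniformLoss c v y := by
  have hK : (K : ℝ) ≠ 0 := Nat.cast_ne_zero.2 (Fin.pos y).ne'
  have hm : ∑ k, margin c k y = (K - 1) * c y := by
    have h : ∀ k, margin c k y = c y - if y = k then c y else 0 := by
      intro k
      by_cases h : y = k <;> simp [margin, h]
    simp [h, Finset.sum_sub_distrib]
    ring
  rw [← Finset.mul_sum, Finset.sum_add_distrib, Finset.sum_sub_distrib, hm]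
  simp only [Finset.sum_const, Finset.card_univ, Fintype.card_fin, nsmul_eq_mul, uniformLoss]
  field_simp

theorem absDiff_top {a : ℝ≥0∞} (ha : a ≠ ∞) : absDiff a ∞ = ∞ := by
  simp [absDiff, ENNReal.top_sub ha]

theorem absDiff_self (a : ℝ≥0∞) : absDiff a a = 0 := by
  simp [absDiff]

theorem ldrKL_top {K : ℕ} (c : Fin K → ℝ) (v : Score K) (y : Fin K) :
    ldrKL c ∞ v y = (uniformLoss c v y : EReal) := by
  have hK : K ≠ 0 := (Fin.pos y).ne'
  apply le_antisymm
  · refine iSup₂_le fun p hp => ?_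
    rcases (klUniform_nonneg hp).eq_or_lt with h | h
    · have hp' : p = fun _ => (K : ℝ)⁻¹ := funext (eq_inv_of_klUniform_eq_zero hp h.symm)
      subst hp'
      rw [← h, sum_uniform_mul_margin]
      simp
    · rw [ENNReal.top_mul (ENNReal.ofReal_pos.2 h).ne', EReal.coe_ennreal_top, EReal.sub_top]
      exact bot_le
  · refine le_iSup₂_of_le _ (uniform_mem_stdSimplex hK) ?_
    rw [klUniform_uniform, sum_uniform_mul_margin]
    simp

theorem aldrKL_top {K : ℕ} {α : ℝ} (hα : 0 < α) (c : Fin K → ℝ) (v : Score K) (y : Fin K) :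
    aldrKL α ∞ c v y = (uniformLoss c v y : EReal) := by
  apply le_antisymm
  · refine iSup_le fun lam => ?_
    rcases eq_or_ne lam ∞ with rfl | h
    · simp [absDiff_self, ldrKL_top]
    · have hα' : ENNReal.ofReal (α / 2) ≠ 0 := (ENNReal.ofReal_pos.2 (by positivity)).ne'
      rw [absDiff_top h, ENNReal.top_pow two_ne_zero, ENNReal.mul_top hα', EReal.coe_ennreal_top,
        EReal.sub_top]
      exact bot_le
  · refine le_iSup_of_le ∞ ?_
    simp [absDiff_self, ldrKL_top]

theorem isSymmetricLoss_aldrKL_top {K : ℕ} {α : ℝ} (hα : 0 < α) (c : Fin K → ℝ) :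
    IsSymmetricLoss (aldrKL α ∞ c) := by
  refine ⟨∑ j, (K - 1) / K * c j, fun v => ?_⟩
  rcases eq_or_ne K 0 with rfl | hK
  · simp
  have hK' : (K : ℝ) ≠ 0 := Nat.cast_ne_zero.2 hK
  have h : ∑ j, uniformLoss c v j = ∑ j, ((K : ℝ) - 1) / K * c j := by
    simp only [uniformLoss, Finset.sum_add_distrib, Finset.sum_sub_distrib, Finset.sum_const,
      Finset.card_univ, Fintype.card_fin, nsmul_eq_mul]
    field_simp
    ring
  simp only [aldrKL_top hα, ← h]
  exact (map_sum (⟨⟨Real.toEReal, EReal.coe_zero⟩, EReal.coe_add⟩ : ℝ →+ EReal) _ _).symm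

/-! ### Exchanging two labels -/

/-- The linear isometry of score space that exchanges the coordinates `i` and `j`. -/
noncomputable def swapScore {K : ℕ} (i j : Fin K) : Score K ≃ₗᵢ[ℝ] Score K :=
  LinearIsometryEquiv.piLpCongrLeft 2 ℝ ℝ (Equiv.swap i j)

@[simp]
theorem swapScore_apply {K : ℕ} (i j : Fin K) (v : Score K) (k : Fin K) :
    swapScore i j v k = v (Equiv.swap i j k) := by
  simp [swapScore, LinearIsometryEquiv.piLpCongrLeft_apply, Equiv.piCongrLeft']

/-- Exchanging two coordinates that `v` orders against `q` does not decrease the pairing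
with `q`. -/
theorem sum_mul_le_sum_mul_swap {K : ℕ} {q v : Score K} {i j : Fin K} (hq : q j ≤ q i)
    (hv : v i ≤ v j) : ∑ k, q k * v k ≤ ∑ k, q k * v (Equiv.swap i j k) := by
  have hsymm : ∑ k, q (Equiv.swap i j k) * v (Equiv.swap i j k) = ∑ k, q k * v k :=
    Equiv.sum_comp (Equiv.swap i j) fun k => q k * v k
  have hsymm' : ∑ k, q (Equiv.swap i j k) * v k = ∑ k, q k * v (Equiv.swap i j k) := by
    rw [← Equiv.sum_comp (Equiv.swap i j)]
    simp
  have hnn : 0 ≤ ∑ k, (q k - q (Equiv.swap i j k)) * (v (Equiv.swap i j k) - v k) := by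
    refine Finset.sum_nonneg fun k _ => ?_
    by_cases h1 : k = i
    · subst h1
      simpa using mul_nonneg (sub_nonneg.2 hq) (sub_nonneg.2 hv)
    by_cases h2 : k = j
    · subst h2
      simpa using mul_nonneg_of_nonpos_of_nonpos (sub_nonpos.2 hq) (sub_nonpos.2 hv)
    · simp [Equiv.swap_apply_of_ne_of_ne h1 h2]
  simp only [sub_mul, mul_sub, Finset.sum_sub_distrib, hsymm, hsymm'] at hnn
  linarith

/-! ### Consistency for infinite regularization on a ball -/

theorem condRisk_uniformLoss {K : ℕ} (c : Fin K → ℝ) {q : Score K}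
    (hq : ⇑q ∈ stdSimplex ℝ (Fin K)) (v : Score K) :
    condRisk (uniformLoss c) q v
      = ∑ y, q y * ((K - 1) / K * c y) - ∑ k, (q k - (K : ℝ)⁻¹) * v k := by
  have h : ∑ y, q y * ((∑ k, v k) / K) = (∑ k, v k) / K := by
    rw [← Finset.sum_mul, hq.2, one_mul]
  simp only [condRisk, uniformLoss, mul_add, mul_sub, sub_mul, Finset.sum_add_distrib,
    Finset.sum_sub_distrib, h, ← Finset.mul_sum]
  ring

theorem isAllKConsistent_aldrKL_top {K : ℕ} {α : ℝ} (hα : 0 < α) (c : Fin K → ℝ) {B : ℝ}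
    (hB : 0 < B) {X : Type*} [MeasurableSpace X] (P : Measure (X × Fin K))
    [IsProbabilityMeasure P] :
    IsAllKConsistent P {v : Score K | ‖v‖ ≤ B} (aldrKL α ∞ c) := by
  have hℓ : aldrKL α ∞ c = fun v y => (uniformLoss c v y : EReal) :=
    funext fun v => funext fun y => aldrKL_top hα c v y
  rw [hℓ]
  have hcont : ∀ y, Continuous fun v : Score K => uniformLoss c v y := fun y => by
    unfold uniformLoss
    fun_prop
  -- A continuous loss is bounded on the compact ball.
  obtain ⟨M, hM⟩ : ∃ M, ∀ v ∈ {v : Score K | ‖v‖ ≤ B}, ∀ y, -M ≤ uniformLoss c v y := by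
    have hball : {v : Score K | ‖v‖ ≤ B} = Metric.closedBall 0 B := by
      ext v
      simp
    have hb : ∀ y, ∃ m, ∀ v ∈ {v : Score K | ‖v‖ ≤ B}, m ≤ uniformLoss c v y := fun y => by
      obtain ⟨m, hm⟩ := (isCompact_closedBall (0 : Score K) B).bddBelow_image
        (hcont y).continuousOn
      exact ⟨m, fun v hv => hm ⟨v, hball ▸ hv, rfl⟩⟩
    choose m hm using hb
    refine ⟨∑ y, |m y|, fun v hv y => ?_⟩
    have h1 := Finset.single_le_sum (f := fun y => |m y|) (fun y _ => abs_nonneg _)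
      (Finset.mem_univ y)
    have h2 := hm y v hv
    have h3 := neg_abs_le (m y)
    linarith
  refine isAllKConsistent_of_improvement P ⟨0, by simpa using hB.le⟩
    (fun y => (hcont y).measurable) hM fun i j => ?_
  let u : Score K := WithLp.toLp 2 fun _ => (K : ℝ)⁻¹
  refine ⟨fun q _ => (B * ‖q - u‖⁻¹) • (q - u),
    fun q => B * (‖q - u‖ - ‖(1 / 2 : ℝ) • ((q - u) + swapScore i j (q - u))‖), ?_, ?_, ?_, ?_⟩
  · change Measurable fun z : Score K × Score K => (B * ‖z.1 - u‖⁻¹) • (z.1 - u)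
    fun_prop
  · exact Continuous.measurable (by fun_prop)
  · intro q v _
    simp only [Set.mem_ofPred_eq, norm_smul, norm_mul, norm_inv, abs_norm, Real.norm_eq_abs,
      abs_of_pos hB]
    rw [mul_assoc]
    exact mul_le_of_le_one_right hB.le (inv_mul_le_one)
  · intro q hq hlt
    set w := q - u with hw
    have hwk : ∀ k, w k = q k - (K : ℝ)⁻¹ := fun k => by simp [hw, u]
    have hwlt : w j < w i := by
      rw [hwk, hwk]
      linarith
    have hne : w ≠ swapScore i j w := fun h => by
      have := congrArg (fun s : Score K => s i) h
      simp only [swapScore_apply, Equiv.swap_apply_left] at this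
      linarith
    have hw0 : ‖w‖ ≠ 0 := fun h => by
      rw [norm_eq_zero] at h
      exact hne (by rw [h, map_zero])
    have hnorm : ‖(1 / 2 : ℝ) • (w + swapScore i j w)‖ < ‖w‖ :=
      (norm_midpoint_lt_iff ((swapScore i j).norm_map w).symm).2 hne
    refine ⟨mul_pos hB (sub_pos.2 hnorm), fun v hv hij => ?_⟩
    rw [condRisk_uniformLoss c hq, condRisk_uniformLoss c hq]
    simp only [← hwk]
    have hopt : ∑ k, w k * ((B * ‖w‖⁻¹) • w) k = B * ‖w‖ := by
      have h1 : ∑ k, w k * w k = ‖w‖ ^ 2 := by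
        rw [EuclideanSpace.real_norm_sq_eq]
        exact Finset.sum_congr rfl fun k _ => (sq _).symm
      have h2 : ∑ k, w k * ((B * ‖w‖⁻¹) • w) k = B * ‖w‖⁻¹ * ∑ k, w k * w k := by
        rw [Finset.mul_sum]
        exact Finset.sum_congr rfl fun k _ => by simp; ring
      rw [h2, h1]
      field_simp
    have hmid : ∑ k, w k * v k ≤ ‖(1 / 2 : ℝ) • (w + swapScore i j w)‖ * B := by
      have h1 := sum_mul_le_sum_mul_swap hwlt.le hij
      have h2 : ∑ k, w (Equiv.swap i j k) * v k = ∑ k, w k * v (Equiv.swap i j k) := by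
        rw [← Equiv.sum_comp (Equiv.swap i j)]
        simp
      have h3 := real_inner_le_norm ((1 / 2 : ℝ) • (w + swapScore i j w)) v
      have h4 : inner ℝ ((1 / 2 : ℝ) • (w + swapScore i j w)) v
          = (∑ k, w k * v k + ∑ k, w (Equiv.swap i j k) * v k) / 2 := by
        rw [PiLp.inner_apply, ← Finset.sum_add_distrib, Finset.sum_div]
        refine Finset.sum_congr rfl fun k _ => ?_
        simp
        ring
      have h5 := mul_le_mul_of_nonneg_left (show ‖v‖ ≤ B from hv)
        (norm_nonneg ((1 / 2 : ℝ) • (w + swapScore i j w)))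
      linarith
    rw [hopt]
    linarith

/-! ### Strong convexity of the divergence under exchange of two labels -/

/-- `x log x - x² / 2` is convex on `[0, 1]`, since its second derivative is `1 / x - 1`. -/
theorem convexOn_mul_log_sub_sq :
    ConvexOn ℝ (Set.Icc (0 : ℝ) 1) fun x => x * Real.log x - x ^ 2 / 2 := by
  refine convexOn_of_hasDerivWithinAt2_nonneg (convex_Icc 0 1)
    (f' := fun x => Real.log x + 1 - x) (f'' := fun x => x⁻¹ - 1)
    ((Real.continuous_mul_log.sub (by fun_prop)).continuousOn) ?_ ?_ ?_
  · intro x hx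
    rw [interior_Icc] at hx
    have h := (Real.hasDerivAt_mul_log hx.1.ne').sub (((hasDerivAt_id x).pow 2).div_const 2)
    refine (h.congr_deriv ?_).hasDerivWithinAt
    simp
  · intro x hx
    rw [interior_Icc] at hx
    exact (((Real.hasDerivAt_log hx.1.ne').add_const 1).sub (hasDerivAt_id x)).hasDerivWithinAt
  · intro x hx
    rw [interior_Icc] at hx
    exact sub_nonneg.2 ((one_le_inv₀ hx.1).2 hx.2.le)

theorem midpoint_mul_log_le {a b : ℝ} (ha : a ∈ Set.Icc (0 : ℝ) 1) (hb : b ∈ Set.Icc (0 : ℝ) 1) :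
    (a + b) / 2 * Real.log ((a + b) / 2)
      ≤ (a * Real.log a + b * Real.log b) / 2 - (a - b) ^ 2 / 8 := by
  have h := convexOn_mul_log_sub_sq.2 ha hb (show (0 : ℝ) ≤ 1 / 2 by norm_num)
    (show (0 : ℝ) ≤ 1 / 2 by norm_num) (by norm_num)
  simp only [smul_eq_mul] at h
  rw [show 1 / 2 * a + 1 / 2 * b = (a + b) / 2 by ring] at h
  linarith

theorem klUniform_eq_entropy {K : ℕ} {p : Fin K → ℝ} (hp : p ∈ stdSimplex ℝ (Fin K)) :
    klUniform p = ∑ k, p k * Real.log (p k) + Real.log K := by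
  have h : ∀ k, p k * Real.log (p k * K) = p k * Real.log (p k) + p k * Real.log K := by
    intro k
    have hK : (K : ℝ) ≠ 0 := Nat.cast_ne_zero.2 (Fin.pos k).ne'
    rcases eq_or_ne (p k) 0 with h0 | h0
    · simp [h0]
    · rw [Real.log_mul h0 hK, mul_add]
  simp only [klUniform, h, Finset.sum_add_distrib, ← Finset.sum_mul, hp.2, one_mul]

theorem le_one_of_mem_stdSimplex {K : ℕ} {p : Fin K → ℝ} (hp : p ∈ stdSimplex ℝ (Fin K))
    (k : Fin K) : p k ≤ 1 :=
  hp.2 ▸ Finset.single_le_sum (fun i _ => hp.1 i) (Finset.mem_univ k)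

theorem klUniform_le_log {K : ℕ} {p : Fin K → ℝ} (hp : p ∈ stdSimplex ℝ (Fin K)) :
    klUniform p ≤ Real.log K := by
  rw [klUniform_eq_entropy hp]
  have h : ∑ k, p k * Real.log (p k) ≤ 0 := Finset.sum_nonpos fun k _ =>
    mul_nonpos_of_nonneg_of_nonpos (hp.1 k)
      (Real.log_nonpos (hp.1 k) (le_one_of_mem_stdSimplex hp k))
  linarith

theorem average_swap_mem_stdSimplex {K : ℕ} {p : Fin K → ℝ} (hp : p ∈ stdSimplex ℝ (Fin K))
    (i j : Fin K) : (fun k => (p k + p (Equiv.swap i j k)) / 2) ∈ stdSimplex ℝ (Fin K) := by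
  refine ⟨fun k => ?_, ?_⟩
  · have h1 := hp.1 k
    have h2 := hp.1 (Equiv.swap i j k)
    positivity
  · rw [← Finset.sum_div, Finset.sum_add_distrib, Equiv.sum_comp (Equiv.swap i j) p, hp.2]
    norm_num

/-- Averaging two entries of a probability vector lowers its divergence from the uniform one
quadratically in their difference. -/
theorem klUniform_average_swap_le {K : ℕ} {p : Fin K → ℝ} (hp : p ∈ stdSimplex ℝ (Fin K))
    (i j : Fin K) :
    klUniform (fun k => (p k + p (Equiv.swap i j k)) / 2) ≤ klUniform p - (p i - p j) ^ 2 / 8 := by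
  rw [klUniform_eq_entropy (average_swap_mem_stdSimplex hp i j), klUniform_eq_entropy hp]
  have hmem : ∀ k, p k ∈ Set.Icc (0 : ℝ) 1 := fun k => ⟨hp.1 k, le_one_of_mem_stdSimplex hp k⟩
  have h1 := Finset.sum_le_sum fun k (_ : k ∈ Finset.univ) =>
    midpoint_mul_log_le (hmem k) (hmem (Equiv.swap i j k))
  rw [Finset.sum_sub_distrib, ← Finset.sum_div, Finset.sum_add_distrib,
    Equiv.sum_comp (Equiv.swap i j) fun k => p k * Real.log (p k), ← Finset.sum_div] at h1
  have h2 := Finset.single_le_sum (f := fun k => (p k - p (Equiv.swap i j k)) ^ 2)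
    (fun k _ => sq_nonneg _) (Finset.mem_univ i)
  rw [Equiv.swap_apply_left] at h2
  linarith

/-- The correction of a score vector that orders the labels `i` and `j` wrongly: the two scores are
replaced by their mean, which is then raised by `ε` for `i` and lowered by `ε` for `j`. -/
noncomputable def separateScore {K : ℕ} (i j : Fin K) (ε : ℝ) (v : Score K) : Score K :=
  (1 / 2 : ℝ) • (v + swapScore i j v)
    + ε • (EuclideanSpace.single i 1 - EuclideanSpace.single j 1)

theorem sum_mul_separateScore {K : ℕ} (i j : Fin K) (ε : ℝ) (v : Score K) (p : Fin K → ℝ) :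
    ∑ k, p k * separateScore i j ε v k
      = (∑ k, p k * v k + ∑ k, p k * v (Equiv.swap i j k)) / 2 + ε * (p i - p j) := by
  have h : ∀ l : Fin K, ∑ k, p k * (EuclideanSpace.single l (1 : ℝ) : Score K) k = p l := by
    intro l
    simp
  rw [← h i, ← h j, ← Finset.sum_add_distrib, ← Finset.sum_sub_distrib, Finset.mul_sum,
    Finset.sum_div, ← Finset.sum_add_distrib]
  refine Finset.sum_congr rfl fun k _ => ?_
  simp only [separateScore, PiLp.add_apply, PiLp.smul_apply, PiLp.sub_apply, swapScore_apply,
    smul_eq_mul]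
  ring

/-! ### The adaptive loss with finite target -/

/-- What remains of the two penalties once the regularization parameter is optimized out: for a
probability vector of divergence `t`, the maximum over real `lam` of `-lam t - (α / 2) (lam - lam0)²` is
`-(lam0 t - t² / (2 α))`. -/
noncomputable def adaptivePenalty {K : ℕ} (α lam0 : ℝ) (p : Fin K → ℝ) : ℝ :=
  lam0 * klUniform p - klUniform p ^ 2 / (2 * α)

/-- The label-independent part of the adaptive loss without margins: the convex conjugate of
`adaptivePenalty` on the simplex. -/
noncomputable def adaptiveConjugate {K : ℕ} (α lam0 : ℝ) (v : Score K) : ℝ :=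
  ⨆ p : stdSimplex ℝ (Fin K), (∑ k, (p : Fin K → ℝ) k * v k - adaptivePenalty α lam0 p)

section Adaptive

variable {K : ℕ} {α lam0 : ℝ}

theorem adaptivePenalty_nonneg (hα : 0 < α) (hlam : Real.log K < α * lam0) {p : Fin K → ℝ}
    (hp : p ∈ stdSimplex ℝ (Fin K)) : 0 ≤ adaptivePenalty α lam0 p := by
  have h0 := klUniform_nonneg hp
  have h1 := klUniform_le_log hp
  have h2 : adaptivePenalty α lam0 p
      = klUniform p * (2 * (α * lam0) - klUniform p) / (2 * α) := by
    rw [adaptivePenalty]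
    field_simp
  rw [h2]
  exact div_nonneg (mul_nonneg h0 (by linarith)) (by positivity)

theorem adaptivePenalty_le (hα : 0 < α) (hlam0 : 0 < lam0) {p : Fin K → ℝ}
    (hp : p ∈ stdSimplex ℝ (Fin K)) : adaptivePenalty α lam0 p ≤ lam0 * Real.log K := by
  have h1 := mul_le_mul_of_nonneg_left (klUniform_le_log hp) hlam0.le
  have h2 : 0 ≤ klUniform p ^ 2 / (2 * α) := by positivity
  rw [adaptivePenalty]
  linarith

/-- The penalty as a function of the divergence `t ≤ log K` has slope at least
`lam0 - log K / α`. -/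
theorem adaptivePenalty_sub_ge (hα : 0 < α) {p p' : Fin K → ℝ}
    (hp : p ∈ stdSimplex ℝ (Fin K)) (hp' : p' ∈ stdSimplex ℝ (Fin K))
    (h : klUniform p' ≤ klUniform p) :
    (lam0 - Real.log K / α) * (klUniform p - klUniform p')
      ≤ adaptivePenalty α lam0 p - adaptivePenalty α lam0 p' := by
  have h1 := klUniform_le_log hp
  have h2 := klUniform_le_log hp'
  have h3 : adaptivePenalty α lam0 p - adaptivePenalty α lam0 p'
      - (lam0 - Real.log K / α) * (klUniform p - klUniform p')
      = (klUniform p - klUniform p') * (2 * Real.log K - klUniform p - klUniform p')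
        / (2 * α) := by
    rw [adaptivePenalty, adaptivePenalty]
    field_simp
    ring
  have h4 : 0 ≤ (klUniform p - klUniform p') * (2 * Real.log K - klUniform p - klUniform p')
        / (2 * α) := div_nonneg (mul_nonneg (by linarith) (by linarith)) (by positivity)
  linarith

theorem sum_mul_le_of_mem_stdSimplex {p : Fin K → ℝ} (hp : p ∈ stdSimplex ℝ (Fin K))
    (v : Score K) : ∑ k, p k * v k ≤ ∑ k, |v k| := by
  refine Finset.sum_le_sum fun k _ => ?_
  calc p k * v k ≤ p k * |v k| := mul_le_mul_of_nonneg_left (le_abs_self _) (hp.1 k)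
    _ ≤ |v k| := mul_le_of_le_one_left (abs_nonneg _) (le_one_of_mem_stdSimplex hp k)

theorem bddAbove_adaptiveConjugate (hα : 0 < α) (hlam : Real.log K < α * lam0) (v : Score K) :
    BddAbove (Set.range fun p : stdSimplex ℝ (Fin K) =>
      ∑ k, (p : Fin K → ℝ) k * v k - adaptivePenalty α lam0 p) := by
  refine ⟨∑ k, |v k|, ?_⟩
  rintro _ ⟨p, rfl⟩
  have h1 : ∑ k, p k * v k ≤ ∑ k, |v k| := sum_mul_le_of_mem_stdSimplex p.2 v
  have h2 : 0 ≤ adaptivePenalty α lam0 p := adaptivePenalty_nonneg hα hlam p.2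
  change ∑ k, p k * v k - adaptivePenalty α lam0 p ≤ _
  linarith

theorem le_adaptiveConjugate (hα : 0 < α) (hlam : Real.log K < α * lam0) (v : Score K)
    {p : Fin K → ℝ} (hp : p ∈ stdSimplex ℝ (Fin K)) :
    ∑ k, p k * v k - adaptivePenalty α lam0 p ≤ adaptiveConjugate α lam0 v :=
  le_ciSup (bddAbove_adaptiveConjugate hα hlam v) ⟨p, hp⟩

theorem measurable_adaptiveConjugate (hα : 0 < α) (hlam : Real.log K < α * lam0) :
    Measurable (adaptiveConjugate (K := K) α lam0) := by
  have h : LowerSemicontinuous fun v : Score K => ⨆ p : stdSimplex ℝ (Fin K),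
      (∑ k, (p : Fin K → ℝ) k * v k - adaptivePenalty α lam0 p) :=
    lowerSemicontinuous_ciSup (fun v => bddAbove_adaptiveConjugate hα hlam v)
      fun p => Continuous.lowerSemicontinuous (by fun_prop)
  exact h.measurable

/-- The supremum over the simplex is attained. -/
theorem exists_eq_adaptiveConjugate (hK : K ≠ 0) (v : Score K) :
    ∃ p ∈ stdSimplex ℝ (Fin K),
      adaptiveConjugate α lam0 v = ∑ k, p k * v k - adaptivePenalty α lam0 p := by
  have hcont : ContinuousOn (fun p : Fin K → ℝ => ∑ k, p k * v k - adaptivePenalty α lam0 p)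
      (stdSimplex ℝ (Fin K)) := by
    have hkl : ContinuousOn (klUniform (K := K)) (stdSimplex ℝ (Fin K)) := by
      refine ContinuousOn.congr (f := fun p : Fin K → ℝ =>
        ∑ k, p k * Real.log (p k) + Real.log K) ?_ fun p hp => klUniform_eq_entropy hp
      refine Continuous.continuousOn ((continuous_finsetSum _ fun k _ => ?_).add continuous_const)
      exact Real.continuous_mul_log.comp (continuous_apply k)
    unfold adaptivePenalty
    fun_prop
  obtain ⟨p, hp, hmax⟩ := (isCompact_stdSimplex ℝ (Fin K)).exists_isMaxOn
    ⟨_, uniform_mem_stdSimplex hK⟩ hcont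
  have : Nonempty (stdSimplex ℝ (Fin K)) := ⟨⟨p, hp⟩⟩
  refine ⟨p, hp, le_antisymm (ciSup_le fun p' => hmax p'.2) ?_⟩
  refine le_ciSup (f := fun p : stdSimplex ℝ (Fin K) =>
    ∑ k, (p : Fin K → ℝ) k * v k - adaptivePenalty α lam0 p)
      ⟨∑ k, p k * v k - adaptivePenalty α lam0 p, ?_⟩ ⟨p, hp⟩
  rintro _ ⟨p', rfl⟩
  exact hmax p'.2

/-- The correction of a score vector changes the conjugate by at most a quantity quadratic in `ε`.
For a probability vector `p` the pairing with the corrected vector is that of the averaged vector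
`(p + p ∘ swap) / 2` with `v` plus `ε (p i - p j)`, and the gain in divergence from averaging pays
for the linear term. -/
theorem adaptiveConjugate_separateScore_le (hα : 0 < α) (hlam : Real.log K < α * lam0) (hK : K ≠ 0)
    (i j : Fin K) (v : Score K) (ε : ℝ) :
    adaptiveConjugate α lam0 (separateScore i j ε v)
      ≤ adaptiveConjugate α lam0 v + 2 * ε ^ 2 / (lam0 - Real.log K / α) := by
  have hpos : 0 < lam0 - Real.log K / α := by
    rw [sub_pos, div_lt_iff₀ hα]
    linarith
  obtain ⟨p, hp, hpv⟩ := exists_eq_adaptiveConjugate (α := α) (lam0 := lam0) hK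
    (separateScore i j ε v)
  have havg := average_swap_mem_stdSimplex hp i j
  have hkl := klUniform_average_swap_le hp i j
  have hpen := adaptivePenalty_sub_ge (lam0 := lam0) hα hp havg
    (by nlinarith [sq_nonneg (p i - p j)])
  have hle := le_adaptiveConjugate hα hlam v havg
  have hpair : ∑ k, p k * separateScore i j ε v k
      = ∑ k, (p k + p (Equiv.swap i j k)) / 2 * v k + ε * (p i - p j) := by
    rw [sum_mul_separateScore]
    have h1 : ∑ k, p (Equiv.swap i j k) * v k = ∑ k, p k * v (Equiv.swap i j k) := by
      rw [← Equiv.sum_comp (Equiv.swap i j)]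
      simp
    rw [← h1, ← Finset.sum_add_distrib, Finset.sum_div]
    exact congrArg (· + _) (Finset.sum_congr rfl fun k _ => by ring)
  rw [hpv, hpair]
  have hgain := mul_le_mul_of_nonneg_left hkl hpos.le
  -- Completing the square in `p i - p j`.
  have hsq : ε * (p i - p j) ≤ (lam0 - Real.log K / α) * ((p i - p j) ^ 2 / 8)
      + 2 * ε ^ 2 / (lam0 - Real.log K / α) := by
    generalize lam0 - Real.log K / α = m at hpos
    have h : m * ((p i - p j) ^ 2 / 8) + 2 * ε ^ 2 / m - ε * (p i - p j)
        = (m * (p i - p j) - 4 * ε) ^ 2 / (8 * m) := by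
      field_simp
      ring
    have h' : 0 ≤ (m * (p i - p j) - 4 * ε) ^ 2 / (8 * m) := by positivity
    linarith
  linarith

/-- Without margins, the adaptive loss is its conjugate part minus the score of the label. The
optimal regularization parameter for a given probability vector is `lam0 - KL / α`; it is
nonnegative because `KL ≤ log K < α lam0`. -/
theorem aldrKL_eq (hα : 0 < α) (hlam0 : 0 < lam0) (hlam : Real.log K < α * lam0)
    {c : Fin K → ℝ} (hc : ∀ y, c y = 0) (v : Score K) (y : Fin K) :
    aldrKL α (ENNReal.ofReal lam0) c v y = ((adaptiveConjugate α lam0 v - v y : ℝ) : EReal) := by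
  have hmargin : ∀ k, margin c k y = 0 := fun k => by simp [margin, hc]
  have hpair : ∀ p ∈ stdSimplex ℝ (Fin K),
      ∑ k, p k * (v k - v y + margin c k y) = ∑ k, p k * v k - v y := by
    intro p hp
    simp only [hmargin, add_zero, mul_sub, Finset.sum_sub_distrib, ← Finset.sum_mul, hp.2, one_mul]
  have habs : ∀ a : ℝ, 0 ≤ a →
      ((ENNReal.ofReal (α / 2) * absDiff (ENNReal.ofReal a) (ENNReal.ofReal lam0) ^ 2 : ℝ≥0∞)
        : EReal) = ((α / 2 * (a - lam0) ^ 2 : ℝ) : EReal) := by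
    intro a ha
    have h : absDiff (ENNReal.ofReal a) (ENNReal.ofReal lam0) = ENNReal.ofReal |a - lam0| := by
      rw [absDiff, ← ENNReal.ofReal_sub _ hlam0.le, ← ENNReal.ofReal_sub _ ha]
      rcases le_total a lam0 with h | h
      · rw [ENNReal.ofReal_of_nonpos (sub_nonpos.2 h), zero_add, abs_of_nonpos (sub_nonpos.2 h),
          neg_sub]
      · rw [ENNReal.ofReal_of_nonpos (sub_nonpos.2 h), add_zero, abs_of_nonneg (sub_nonneg.2 h)]
    rw [h, ← ENNReal.ofReal_pow (abs_nonneg _), sq_abs, ← ENNReal.ofReal_mul (by positivity),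
      EReal.coe_ennreal_ofReal, max_eq_left (by positivity)]
  have hkl : ∀ a : ℝ, 0 ≤ a → ∀ p ∈ stdSimplex ℝ (Fin K),
      ((ENNReal.ofReal a * ENNReal.ofReal (klUniform p) : ℝ≥0∞) : EReal)
        = ((a * klUniform p : ℝ) : EReal) := by
    intro a ha p hp
    rw [← ENNReal.ofReal_mul ha, EReal.coe_ennreal_ofReal,
      max_eq_left (mul_nonneg ha (klUniform_nonneg hp))]
  apply le_antisymm
  · refine iSup_le fun lam => ?_
    rcases eq_or_ne lam ∞ with rfl | hlamfin
    · have h : absDiff ∞ (ENNReal.ofReal lam0) = ∞ := by simp [absDiff]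
      have hα' : ENNReal.ofReal (α / 2) ≠ 0 := (ENNReal.ofReal_pos.2 (by positivity)).ne'
      rw [h, ENNReal.top_pow two_ne_zero, ENNReal.mul_top hα', EReal.coe_ennreal_top,
        EReal.sub_top]
      exact bot_le
    · obtain ⟨a, ha, rfl⟩ : ∃ a : ℝ, 0 ≤ a ∧ lam = ENNReal.ofReal a :=
        ⟨lam.toReal, ENNReal.toReal_nonneg, (ENNReal.ofReal_toReal hlamfin).symm⟩
      rw [habs a ha]
      refine EReal.sub_le_of_le_add (iSup₂_le fun p hp => ?_)
      rw [hkl a ha p hp, hpair p hp, ← EReal.coe_sub, ← EReal.coe_add, EReal.coe_le_coe_iff]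
      have h1 := le_adaptiveConjugate hα hlam v hp
      have h2 : a * klUniform p + α / 2 * (a - lam0) ^ 2 - adaptivePenalty α lam0 p
          = α / 2 * (a - lam0 + klUniform p / α) ^ 2 := by
        rw [adaptivePenalty]
        field_simp
        ring
      have h3 : 0 ≤ α / 2 * (a - lam0 + klUniform p / α) ^ 2 := by positivity
      linarith
  · obtain ⟨p, hp, hpv⟩ := exists_eq_adaptiveConjugate (α := α) (lam0 := lam0) (Fin.pos y).ne' v
    have ha : 0 ≤ lam0 - klUniform p / α := by
      rw [sub_nonneg, div_le_iff₀ hα]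
      linarith [klUniform_le_log hp]
    refine le_iSup_of_le (ENNReal.ofReal (lam0 - klUniform p / α)) ?_
    rw [habs _ ha]
    refine le_trans ?_ (EReal.sub_le_sub (le_iSup₂_of_le p hp le_rfl) le_rfl)
    rw [hkl _ ha p hp, hpair p hp, ← EReal.coe_sub, ← EReal.coe_sub, EReal.coe_le_coe_iff, hpv]
    apply le_of_eq
    rw [adaptivePenalty]
    field_simp
    ring

theorem condRisk_adaptive {q : Score K} (hq : ⇑q ∈ stdSimplex ℝ (Fin K)) (v : Score K) :
    condRisk (fun v y => adaptiveConjugate α lam0 v - v y) q v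
      = adaptiveConjugate α lam0 v - ∑ k, q k * v k := by
  simp only [condRisk, mul_sub, Finset.sum_sub_distrib, ← Finset.sum_mul, hq.2, one_mul]

theorem isAllKConsistent_aldrKL (hα : 0 < α) (hlam0 : 0 < lam0) (hlam : Real.log K < α * lam0)
    {c : Fin K → ℝ} (hc : ∀ y, c y = 0) {X : Type*} [MeasurableSpace X]
    (P : Measure (X × Fin K)) [IsProbabilityMeasure P] :
    IsAllKConsistent P Set.univ (aldrKL α (ENNReal.ofReal lam0) c) := by
  have hℓ : aldrKL α (ENNReal.ofReal lam0) c
      = fun v y => ((adaptiveConjugate α lam0 v - v y : ℝ) : EReal) :=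
    funext fun v => funext fun y => aldrKL_eq hα hlam0 hlam hc v y
  rw [hℓ]
  have hpos : 0 < lam0 - Real.log K / α := by
    rw [sub_pos, div_lt_iff₀ hα]
    linarith
  set m := lam0 - Real.log K / α with hm
  refine isAllKConsistent_of_improvement (M := lam0 * Real.log K) P Set.univ_nonempty
    (ℓ := fun v y => adaptiveConjugate α lam0 v - v y)
    (fun y => (measurable_adaptiveConjugate hα hlam).sub (by fun_prop)) ?_ fun i j => ?_
  · intro v _ y
    -- The point mass at `y` is a competitor in the supremum.
    have hmem : Pi.single y 1 ∈ stdSimplex ℝ (Fin K) := single_mem_stdSimplex ℝ y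
    have h1 := le_adaptiveConjugate hα hlam v hmem
    have h2 := adaptivePenalty_le hα hlam0 hmem
    have h3 : ∑ k, (Pi.single y 1 : Fin K → ℝ) k * v k = v y := by simp [Pi.single_apply]
    linarith
  -- `ε = m (q i - q j) / 4` maximizes `ε (q i - q j) - 2 ε² / m`.
  · refine ⟨fun q v => separateScore i j (m * (q i - q j) / 4) v,
      fun q => m * (q i - q j) ^ 2 / 8, ?_, by fun_prop, fun _ _ _ => Set.mem_univ _, ?_⟩
    · unfold separateScore
      exact Continuous.measurable (by fun_prop)
    · intro q hq hlt
      have hd : 0 < q i - q j := sub_pos.2 hlt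
      refine ⟨by positivity, fun v _ hij => ?_⟩
      rw [condRisk_adaptive hq, condRisk_adaptive hq]
      have hG := adaptiveConjugate_separateScore_le hα hlam (Fin.pos i).ne' i j v (m * (q i - q j) / 4)
      have hswap := sum_mul_le_sum_mul_swap hlt.le hij
      rw [sum_mul_separateScore]
      have h1 : 2 * (m * (q i - q j) / 4) ^ 2 / m = m * (q i - q j) ^ 2 / 8 := by
        field_simp
        ring
      rw [← hm, h1] at hG
      nlinarith

end Adaptive

theorem theorem5 (K : ℕ) (α : ℝ) (hα : 0 < α) (c : Fin K → ℝ) (hc : ∀ y, 0 ≤ c y) :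
    (∀ lam0 : ℝ, 0 < lam0 → (∀ y, c y = 0) → Real.log K / lam0 < α →
      ∀ (X : Type*) [MeasurableSpace X] (P : Measure (X × Fin K)) [IsProbabilityMeasure P],
        IsAllKConsistent P Set.univ (aldrKL α (ENNReal.ofReal lam0) c)) ∧
    (∀ B : ℝ, 0 < B →
      ∀ (X : Type*) [MeasurableSpace X] (P : Measure (X × Fin K)) [IsProbabilityMeasure P],
        IsAllKConsistent P {v : Score K | ‖v‖ ≤ B} (aldrKL α ∞ c)) ∧
    IsSymmetricLoss (aldrKL α ∞ c) :=
  ⟨fun _ hlam0 hc0 hlt _ _ P _ =>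
      isAllKConsistent_aldrKL hα hlam0 ((div_lt_iff₀ hlam0).1 hlt) hc0 P,
    fun _ hB _ _ P _ => isAllKConsistent_aldrKL_top hα c hB P,
    isSymmetricLoss_aldrKL_top hα c⟩
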